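/- **Setting.** A *dual pair* $(X,\mathcal F)$ consists of a Banach space $X$ and a norm-closed subspace $\mathcal F$ of $X^*$ such that: $\|x\|=\sup\{|\varphi(x)|:\varphi\in\mathcal F,\ \|\varphi\|\le 1\}$ for $x\in X$ and $\|\varphi\|=\sup\{|\varphi(x)|:x\in X,\ \|x\|\le 1\}$ for $\varphi\in\mathcal F$; the convex hull of every relatively $\sigma(X,\mathcal F)$-compact subset of $X$ is relatively $\sigma(X,\mathcal F)$-compact; and the convex hull of every relatively $\sigma(\mathcal F,X)$-compact subset of $\mathcal F$ is relatively $\sigma(\mathcal F,X)$-compact. The topology $\sigma(X,\mathcal F)$ is called the $\mathcal F$-topology, and $\overline{S}^{\sigma}$ denotes the closure of $S$ in it. On $X\otimes M_n(\mathbb C)=M_n(X)$ the $\mathcal F$-topology is the weak topology defined by $\mathcal F\otimes M_n(\mathbb C)^*$ (entrywise $\mathcal F$-convergence). An *$\mathcal F$-dynamical system* $(X,G,\alpha)$ consists of a dual pair $(X,\mathcal F)$ in which $X$ is a (not necessarily unital) C*-algebra whose involution is $\mathcal F$-continuous and whose multiplication is separately $\mathcal F$-continuous, a compact (Hausdorff)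 group $G$, and a homomorphism $\alpha$ from $G$ to the group of $*$-automorphisms of $X$ such that every $\alpha_g$ is $\mathcal F$-continuous and $g\mapsto\varphi(\alpha_g(x))$ is continuous for all $x\in X$, $\varphi\in\mathcal F$. Put $X^\alpha=\{x\in X:\alpha_g(x)=x\text{ for all }g\in G\}$. Let $\widehat G$ be the set of unitary equivalence classes of (continuous) irreducible unitary representations of $G$; for each class fix a representative $\pi$, on the finite-dimensional Hilbert space $H_\pi$. Products of sets of algebra elements denote the linear spans of the products of their elements. For an $\alpha$-invariant $\mathcal F$-closed C*-subalgebra $Y$ of $X$ and $\pi\in\widehat G$, let $$Y_2(\pi)=\{a\in Y\otimes B(H_\pi):(\alpha_g\otimes\iota)(a)=a(1\otimes\pi_g)\ \text{for all } g\in G\},$$ where $\iota$ is the identity map of $B(H_\pi)$, and let $(Y\otimes B(H_\pi))^{\alpha\otimes \mathrm{ad}\,\pi}$ be the set of all $a\in Y\otimes B(H_\pi)$ with $(1\otimes\pi_g)\,(\alpha_g\otimes\iota)(a)\,(1\otimes\pi_{g^{-1}})=a$ for all $g\in G$. The spectrum $sp_{\mathcal F}(\alpha|_Y)$ is the set of those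 $\pi\in\widehat G$ for which the ideal $\overline{Y_2(\pi)^*Y_2(\pi)}^{\sigma}$ is essential in $(Y\otimes B(H_\pi))^{\alpha\otimes \mathrm{ad}\,\pi}$, i.e. has zero annihilator there. The *Connes spectrum* of $\alpha$ is $$\Gamma_{\mathcal F}(\alpha)=\bigcap\{sp_{\mathcal F}(\alpha|_Y): Y\in\mathcal H^\alpha_\sigma(X)\},$$ where $\mathcal H^\alpha_\sigma(X)$ is the set of all nonzero $\alpha$-invariant $\mathcal F$-closed hereditary C*-subalgebras of $X$. (Intersections of families of subsets of $\widehat G$ are taken in $\widehat G$.) **Theorem 4.1.** Let $(X,G,\alpha)$ be an $\mathcal F$-dynamical system. Then $$\Gamma_{\mathcal F}(\alpha)=\bigcap\{sp_{\mathcal F}(\alpha|_{\overline{JXJ}^{\sigma}}): J\subset X^\alpha\text{ a nonzero }\mathcal F\text{-closed two-sided ideal of }X^\alpha\}.$$ -/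

import Mathlib

open scoped Topology

/-! ### Dual pairs of Banach spaces and the `F`-topologies -/

section DualPair

variable {X : Type*} [NormedAddCommGroup X] [NormedSpace ℂ X]

/-- The `F`-topology on `X`, i.e. `σ(X, F)`: the coarsest topology making every `φ ∈ F`
continuous. -/
noncomputable abbrev weakTop (F : Submodule ℂ (StrongDual ℂ X)) : TopologicalSpace X :=
  TopologicalSpace.induced (fun (x : X) (φ : F) => (φ : StrongDual ℂ X) x) Pi.topologicalSpace

/-- The `X`-topology on `F`, i.e. `σ(F, X)`: the topology of pointwise convergence on `X`. -/
noncomputable abbrev weakStarTop (F : Submodule ℂ (StrongDual ℂ X)) : TopologicalSpace F :=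
  TopologicalSpace.induced (fun (φ : F) (x : X) => (φ : StrongDual ℂ X) x) Pi.topologicalSpace

/-- The `F`-topology on `X ⊗ Mₙ(ℂ) = Mₙ(X)`, i.e. the weak topology defined by `F ⊗ Mₙ(ℂ)*`: the
coarsest topology making all the maps `a ↦ φ (a i j)`, `φ ∈ F`, continuous. -/
noncomputable abbrev weakMatrixTop (F : Submodule ℂ (StrongDual ℂ X)) (n : ℕ) :
    TopologicalSpace (Matrix (Fin n) (Fin n) X) :=
  TopologicalSpace.induced
    (fun (a : Matrix (Fin n) (Fin n) X) (p : F × Fin n × Fin n) =>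
      (p.1 : StrongDual ℂ X) (a p.2.1 p.2.2)) Pi.topologicalSpace

/-- `(X, F)` is a dual pair of Banach spaces (completeness of `X` is a separate instance). A set is
relatively compact when its closure is compact. -/
structure IsDualPair (F : Submodule ℂ (StrongDual ℂ X)) : Prop where
  /-- `F` is a Banach subspace of the dual of `X`. -/
  isClosed : IsClosed (F : Set (StrongDual ℂ X))
  /-- `F` is norming for `X`. -/
  norm_eq_left : ∀ x : X, IsLUB {r : ℝ | ∃ φ ∈ F, ‖φ‖ ≤ 1 ∧ r = ‖φ x‖} ‖x‖
  /-- `X` is norming for `F`. -/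
  norm_eq_right : ∀ φ ∈ F, IsLUB {r : ℝ | ∃ x : X, ‖x‖ ≤ 1 ∧ r = ‖φ x‖} ‖φ‖
  /-- The convex hull of a relatively `F`-compact subset of `X` is relatively `F`-compact. -/
  convexHull_left : ∀ K : Set X, @IsCompact X (weakTop F) (closure[weakTop F] K) →
    @IsCompact X (weakTop F) (closure[weakTop F] (convexHull ℝ K))
  /-- The convex hull of a relatively `X`-compact subset of `F` is relatively `X`-compact. -/
  convexHull_right : ∀ K : Set F, @IsCompact F (weakStarTop F) (closure[weakStarTop F] K) →
    @IsCompact F (weakStarTop F) (closure[weakStarTop F] (convexHull ℝ K))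

end DualPair

/-! ### The dual `Ĝ` of a compact group -/

section UnitaryDual

/-- A continuous irreducible unitary representation of `G` on `ℂᵈ`, written in matrix form. (For a
compact group every irreducible unitary representation is unitarily equivalent to one of these.) -/
structure UnitaryIrrep (G : Type*) [Group G] [TopologicalSpace G] where
  /-- The dimension `d`. -/
  dim : ℕ
  /-- The homomorphism `G → U(d)`. -/
  hom : G →* Matrix.unitaryGroup (Fin dim) ℂ
  continuous_hom : Continuous hom
  dim_pos : 0 < dim
  /-- The only invariant subspaces of `ℂᵈ` are the trivial ones. -/
  irreducible : ∀ W : Submodule ℂ (Fin dim → ℂ),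
    (∀ g, ∀ w ∈ W, (hom g : Matrix (Fin dim) (Fin dim) ℂ).mulVec w ∈ W) → W = ⊥ ∨ W = ⊤

variable {G : Type*} [Group G] [TopologicalSpace G]

/-- The unitary matrix `π_g`. -/
def UnitaryIrrep.mat (π : UnitaryIrrep G) (g : G) : Matrix (Fin π.dim) (Fin π.dim) ℂ := π.hom g

/-- Unitary equivalence: a unitary `U` with `π_g U = U ρ_g` for all `g`. -/
def UnitaryIrrep.Equivalent (π ρ : UnitaryIrrep G) : Prop :=
  ∃ U : Matrix (Fin π.dim) (Fin ρ.dim) ℂ,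
    U * U.conjTranspose = 1 ∧ U.conjTranspose * U = 1 ∧ ∀ g, π.mat g * U = U * ρ.mat g

theorem UnitaryIrrep.equivalent_equivalence :
    Equivalence (UnitaryIrrep.Equivalent (G := G)) where
  refl π := ⟨1, by simp, by simp, by simp⟩
  symm := by
    rintro π ρ ⟨U, h1, h2, h3⟩
    refine ⟨U.conjTranspose, by simpa using h2, by simpa using h1, fun g => ?_⟩
    calc ρ.mat g * U.conjTranspose
        = (U.conjTranspose * U) * ρ.mat g * U.conjTranspose := by rw [h2, Matrix.one_mul]
      _ = U.conjTranspose * (U * ρ.mat g) * U.conjTranspose := by simp only [Matrix.mul_assoc]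
      _ = U.conjTranspose * (π.mat g * U) * U.conjTranspose := by rw [h3]
      _ = U.conjTranspose * π.mat g * (U * U.conjTranspose) := by simp only [Matrix.mul_assoc]
      _ = U.conjTranspose * π.mat g := by rw [h1, Matrix.mul_one]
  trans := by
    rintro π ρ σ ⟨U, h1, h2, h3⟩ ⟨V, k1, k2, k3⟩
    refine ⟨U * V, ?_, ?_, fun g => ?_⟩
    · calc U * V * (U * V).conjTranspose
          = U * (V * V.conjTranspose) * U.conjTranspose := by
            simp only [Matrix.conjTranspose_mul, Matrix.mul_assoc]
        _ = 1 := by rw [k1, Matrix.mul_one, h1]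
    · calc (U * V).conjTranspose * (U * V)
          = V.conjTranspose * (U.conjTranspose * U) * V := by
            simp only [Matrix.conjTranspose_mul, Matrix.mul_assoc]
        _ = 1 := by rw [h2, Matrix.mul_one, k2]
    · rw [← Matrix.mul_assoc, h3, Matrix.mul_assoc, k3, Matrix.mul_assoc]

/-- The setoid of unitary equivalence. -/
def unitaryIrrepSetoid (G : Type*) [Group G] [TopologicalSpace G] : Setoid (UnitaryIrrep G) :=
  ⟨UnitaryIrrep.Equivalent, UnitaryIrrep.equivalent_equivalence⟩

/-- `Ĝ`: the set of unitary equivalence classes of irreducible unitary representations of `G`. -/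
def UnitaryDual (G : Type*) [Group G] [TopologicalSpace G] : Type _ :=
  Quotient (unitaryIrrepSetoid G)

/-- The fixed representative of a class. -/
noncomputable def UnitaryDual.rep (π : UnitaryDual G) : UnitaryIrrep G :=
  Quotient.out (s := unitaryIrrepSetoid G) π

end UnitaryDual

/-! ### `F`-dynamical systems and their spectra -/

section Dynamics

variable {X : Type*} [NonUnitalCStarAlgebra X] {G : Type*} [Group G] [TopologicalSpace G]

/-- `(X, G, α)` is an `F`-dynamical system. -/
structure IsFDynamicalSystem (F : Submodule ℂ (StrongDual ℂ X)) (α : G →* (X ≃⋆ₐ[ℂ] X)) :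
    Prop where
  isDualPair : IsDualPair F
  /-- The involution is `F`-continuous. -/
  continuous_star : Continuous[weakTop F, weakTop F] (fun x : X => star x)
  /-- The multiplication is separately `F`-continuous. -/
  continuous_mul_left : ∀ x : X, Continuous[weakTop F, weakTop F] (fun y : X => x * y)
  continuous_mul_right : ∀ x : X, Continuous[weakTop F, weakTop F] (fun y : X => y * x)
  /-- Each automorphism `α g` is `F`-continuous. -/
  continuous_automorphism : ∀ g : G, Continuous[weakTop F, weakTop F] (fun x : X => α g x)
  /-- Each function `g ↦ φ (α g x)` is continuous. -/
  continuous_orbit : ∀ x : X, ∀ φ ∈ F, Continuous (fun g : G => φ (α g x))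

variable (F : Submodule ℂ (StrongDual ℂ X)) (α : G →* (X ≃⋆ₐ[ℂ] X))

/-- The product `a (1 ⊗ u)` in `X ⊗ Mₙ(ℂ)`. -/
def mulScalarMatrix {n : ℕ} (a : Matrix (Fin n) (Fin n) X) (u : Matrix (Fin n) (Fin n) ℂ) :
    Matrix (Fin n) (Fin n) X :=
  Matrix.of fun i j => ∑ k, u k j • a i k

/-- The product `(1 ⊗ u) a` in `X ⊗ Mₙ(ℂ)`. -/
def scalarMatrixMul {n : ℕ} (u : Matrix (Fin n) (Fin n) ℂ) (a : Matrix (Fin n) (Fin n) X) :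
    Matrix (Fin n) (Fin n) X :=
  Matrix.of fun i j => ∑ k, u i k • a k j

/-- The fixed point set `X^α`. -/
def fixedPoints : Set X := {x | ∀ g, α g x = x}

/-- For an `α`-invariant subalgebra `Y` of `X`, the spectral subspace `Y₂(π)` of `α|_Y`:
all `a ∈ Y ⊗ B(H_π)` with `(α_g ⊗ ι)(a) = a (1 ⊗ π_g)` for all `g`. -/
def spectralSubspace (Y : Set X) (π : UnitaryIrrep G) : Set (Matrix (Fin π.dim) (Fin π.dim) X) :=
  {a | (∀ i j, a i j ∈ Y) ∧ ∀ g, a.map (fun x => α g x) = mulScalarMatrix a (π.mat g)}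

/-- For an `α`-invariant subalgebra `Y` of `X`, the fixed point algebra
`(Y ⊗ B(H_π))^{α ⊗ ad π}`, where `(α_g ⊗ ad π_g)(a) = (1 ⊗ π_g) [α_g(a_ij)] (1 ⊗ π_{g⁻¹})`. -/
def adFixedPoints (Y : Set X) (π : UnitaryIrrep G) : Set (Matrix (Fin π.dim) (Fin π.dim) X) :=
  {a | (∀ i j, a i j ∈ Y) ∧ ∀ g,
    mulScalarMatrix (scalarMatrixMul (π.mat g) (a.map (fun x => α g x))) (π.mat g⁻¹) = a}

/-- The `F`-closure of `Y₂(π)* Y₂(π)`, where a product of two sets stands for the linear span of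
the products of their elements. For `F`-closed `Y` this closure lies in `Y ⊗ B(H_π)`, so that it
makes no difference whether it is taken there or in `X ⊗ B(H_π)`. -/
def spectralIdeal (Y : Set X) (π : UnitaryIrrep G) : Set (Matrix (Fin π.dim) (Fin π.dim) X) :=
  closure[weakMatrixTop F π.dim] (Submodule.span ℂ
    {c | ∃ a ∈ spectralSubspace α Y π, ∃ b ∈ spectralSubspace α Y π, c = a.conjTranspose * b} :
    Set (Matrix (Fin π.dim) (Fin π.dim) X))

/-- A two-sided ideal `I` of `B` is essential when its annihilator in `B` is trivial. -/
def IsEssentialIn {A : Type*} [NonUnitalNonAssocSemiring A] (I B : Set A) : Prop :=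
  ∀ a ∈ B, (∀ b ∈ I, a * b = 0) → a = 0

/-- `sp_F(α|_Y)`, for an `F`-closed `α`-invariant C*-subalgebra `Y` of `X`. -/
def arvesonSpectrum (Y : Set X) : Set (UnitaryDual G) :=
  {π | IsEssentialIn (spectralIdeal F α Y π.rep) (adFixedPoints α Y π.rep)}

/-- Membership in `H_σ^α(X)`: nonzero `α`-invariant `F`-closed hereditary C*-subalgebras of `X`.
(As `G` is a group, `α_g(Y) ⊆ Y` for all `g` means `α_g(Y) = Y` for all `g`.) -/
structure IsInvariantHereditary [PartialOrder X] (Y : NonUnitalStarSubalgebra ℂ X) : Prop where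
  ne_bot : Y ≠ ⊥
  invariant : ∀ g, ∀ y ∈ Y, α g y ∈ Y
  isClosed : IsClosed[weakTop F] (Y : Set X)
  hereditary : ∀ x y : X, y ∈ Y → 0 ≤ x → x ≤ y → x ∈ Y

/-- The Connes spectrum `Γ_F(α)`. -/
def connesSpectrum [PartialOrder X] : Set (UnitaryDual G) :=
  ⋂ (Y : NonUnitalStarSubalgebra ℂ X) (_ : IsInvariantHereditary F α Y),
    arvesonSpectrum F α (Y : Set X)

/-- `J` is a nonzero `F`-closed two-sided ideal of `X^α`. -/
structure IsFixedPointIdeal (J : Submodule ℂ X) : Prop where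
  ne_bot : J ≠ ⊥
  subset : (J : Set X) ⊆ fixedPoints α
  isClosed : IsClosed[weakTop F] (J : Set X)
  mul_mem_left : ∀ x ∈ fixedPoints α, ∀ j ∈ J, x * j ∈ J
  mul_mem_right : ∀ x ∈ fixedPoints α, ∀ j ∈ J, j * x ∈ J

/-- The `F`-closure of `JXJ`, the linear span of all the products `j x k` with `j, k ∈ J` and
`x ∈ X`. -/
def idealCorner (J : Submodule ℂ X) : Set X :=
  closure[weakTop F] (Submodule.span ℂ {z : X | ∃ j ∈ J, ∃ x : X, ∃ k ∈ J, z = j * x * k} : Set X)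

end Dynamics

/-!
The `F`-closure of `JXJ` is hereditary because it is a norm closed algebra `S` with `S X S ⊆ S`: for
`0 ≤ r r* ≤ y ∈ S` an approximate unit of `S` also approximates `r r*`. This gives one inclusion.

For the other one, let `Y` be hereditary and let `a` be an element of `(Y ⊗ B(H_π))^{α ⊗ ad π}`
orthogonal to the spectral ideal, so that `a c* = 0` for all `c ∈ Y₂(π)`. For `z ∈ Y^α` put
`b = a (z ⊗ 1)`, and let `J` be the ideal of those `j ∈ X^α` with `b c* (j ⊗ 1) = 0` for all
`c ∈ X₂(π)`. It contains `Y^α`, since `(y* ⊗ 1) c (z* ⊗ 1) ∈ Y₂(π)` for `y ∈ Y^α` by heredity. For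
`x, y ∈ J` the compression `(x ⊗ 1) b (y ⊗ 1)` lies over the corner of `J` and is orthogonal to its
spectral ideal, so it vanishes when that ideal is essential. Thus `x a_{ik} z y = 0` for all
`x, y, z ∈ Y^α`, and `a = 0` because no nonzero element of `Y` is annihilated by `Y^α`.

The last fact rests on averaging: the Krein property provides the weak integral `p ∈ Y^α` of
`g ↦ α_g(u* u)`, and `u p = 0` makes the weak integral of the positive function
`g ↦ u α_g(u* u) u*` vanish. A positive function with vanishing weak integral is zero, although the
functionals in `F` need not be spanned by positive ones: its products with continuous scalar
functions `r ≥ 0` also have vanishing integral, and one takes for `r` the positive part of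
`Re φ ∘ f`.
-/

section HereditarySubalgebras

open Filter

theorem four_smul_star_mul_mul_eq {R : Type*} [NonUnitalRing R] [StarRing R] [Module ℂ R]
    [IsScalarTower ℂ R R] [SMulCommClass ℂ R R] [StarModule ℂ R] (w s t : R) :
    (4 : ℂ) • (star s * w * t) = star (s + t) * w * (s + t) - star (s - t) * w * (s - t)
      - Complex.I • (star (s + Complex.I • t) * w * (s + Complex.I • t))
      + Complex.I • (star (s - Complex.I • t) * w * (s - Complex.I • t)) := by
  simp only [star_add, star_sub, star_smul, add_mul, sub_mul, mul_add, mul_sub, smul_mul_assoc,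
    mul_smul_comm, Complex.star_def, Complex.conj_I, smul_add, smul_sub, smul_smul, neg_smul,
    smul_neg, neg_mul, Complex.I_mul_I]
  module

theorem norm_algebraMap_sub_inr_le_iff {A : Type*} [NonUnitalCStarAlgebra A] {x : A} {t : ℝ}
    (ht : 0 ≤ t) :
    ‖algebraMap ℝ (Unitization ℂ A) t - x‖ ≤ t ↔ ∀ a : A, ‖t • a - x * a‖ ≤ t * ‖a‖ := by
  rw [sub_eq_add_neg, ← Unitization.inr_neg, Unitization.norm_eq_sup,
    Unitization.algebraMap_eq_inl_comp]
  simp [sub_eq_add_neg, ContinuousLinearMap.opNorm_le_iff ht, Algebra.algebraMap_eq_smul_one,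
    abs_of_nonneg ht]

variable {A : Type*} [NonUnitalCStarAlgebra A] [PartialOrder A] [StarOrderedRing A]

/- The right-hand side consists of norm bounds on left multiples and of a condition on the
involution, all of which survive limits in the `F`-topology. -/
theorem nonneg_and_norm_le_iff {x : A} {t : ℝ} (ht : 0 ≤ t) :
    0 ≤ x ∧ ‖x‖ ≤ t ↔
      IsSelfAdjoint x ∧ ‖x‖ ≤ t ∧ ∀ a : A, ‖t • a - x * a‖ ≤ t * ‖a‖ := by
  have key : IsSelfAdjoint x → ‖x‖ ≤ t → (0 ≤ x ↔ ∀ a : A, ‖t • a - x * a‖ ≤ t * ‖a‖) := by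
    intro hsa hx
    have hsa' : IsSelfAdjoint (x : Unitization ℂ A) := Unitization.isSelfAdjoint_inr.2 hsa
    rw [← norm_algebraMap_sub_inr_le_iff ht, ← Unitization.inr_nonneg_iff,
      nonneg_iff_isSelfAdjoint_and_quasispectrumRestricts, and_iff_right hsa']
    lift t to NNReal using ht
    exact SpectrumRestricts.nnreal_iff_nnnorm hsa'
      (by simpa [← NNReal.coe_le_coe, Unitization.norm_inr] using hx)
  exact ⟨fun h => ⟨.of_nonneg h.1, h.2, (key (.of_nonneg h.1) h.2).1 h.1⟩,
    fun h => ⟨(key h.1 h.2.1).2 h.2.2, h.2.1⟩⟩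

theorem norm_sub_mul_sq_le {e r y : A} (he : IsSelfAdjoint e) (he₁ : ‖e‖ ≤ 1)
    (hr : r * star r ≤ y) : ‖r - e * r‖ ^ 2 ≤ 2 * ‖y - y * e‖ := by
  obtain ⟨w, hw⟩ := CStarAlgebra.nonneg_iff_eq_mul_star_self.1 (sub_nonneg.2 hr)
  have hconj : (r - e * r) * star (r - e * r) ≤ y - y * e - e * (y - y * e) := by
    have hdiff : y - y * e - e * (y - y * e) - (r - e * r) * star (r - e * r) =
        (w - e * w) * star (w - e * w) := by
      rw [← sub_add_cancel y (r * star r), hw]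
      simp only [star_sub, star_mul, he.star_eq, mul_add, add_mul, mul_sub, sub_mul, mul_assoc]
      abel
    exact sub_nonneg.1 (hdiff ▸ mul_star_self_nonneg _)
  calc ‖r - e * r‖ ^ 2 = ‖(r - e * r) * star (r - e * r)‖ := by
        rw [CStarRing.norm_self_mul_star, sq]
    _ ≤ ‖y - y * e - e * (y - y * e)‖ :=
        CStarAlgebra.norm_le_norm_of_nonneg_of_le (mul_star_self_nonneg _) hconj
    _ ≤ ‖y - y * e‖ + ‖e‖ * ‖y - y * e‖ :=
        (norm_sub_le _ _).trans (by gcongr; exact norm_mul_le _ _)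
    _ ≤ 2 * ‖y - y * e‖ := by nlinarith [norm_nonneg (y - y * e)]

theorem exists_filter_tendsto_mul {S : NonUnitalStarSubalgebra ℂ A}
    (hS : IsClosed (S : Set A)) :
    ∃ l : Filter S, l.NeBot ∧ (∀ᶠ e : S in l, IsSelfAdjoint (e : A)) ∧
      ∀ y ∈ S, ∀ r : A, r * star r ≤ y → Tendsto (fun e : S => (e : A) * r) l (𝓝 r) := by
  let _ := CStarAlgebra.spectralOrder S
  have _ := CStarAlgebra.spectralOrderedRing S
  have hl := CStarAlgebra.increasingApproximateUnit S
  refine ⟨CStarAlgebra.approximateUnit S, hl.neBot, ?_, fun y hy r hr => ?_⟩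
  · filter_upwards [hl.eventually_isSelfAdjoint] with e he using congrArg Subtype.val he
  · have hy' : Tendsto (fun e : S => 2 * ‖y - y * e‖) (CStarAlgebra.approximateUnit S) (𝓝 0) := by
      have := (continuous_subtype_val.tendsto _).comp (hl.tendsto_mul_left ⟨y, hy⟩)
      simpa using ((tendsto_const_nhds (x := y)).sub this).norm.const_mul 2
    rw [tendsto_iff_norm_sub_tendsto_zero]
    have hsq : Tendsto (fun e : S => ‖r - e * r‖ ^ 2) (CStarAlgebra.approximateUnit S) (𝓝 0) := by
      refine squeeze_zero' (.of_forall fun _ => sq_nonneg _) ?_ hy'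
      filter_upwards [hl.eventually_isSelfAdjoint, hl.eventually_norm] with e he he₁
      exact norm_sub_mul_sq_le (congrArg Subtype.val he) he₁ hr
    simpa [norm_sub_rev, Real.sqrt_sq] using hsq.sqrt

theorem mem_of_nonneg_of_le {S : NonUnitalStarSubalgebra ℂ A} (hS : IsClosed (S : Set A))
    (hcorner : ∀ s ∈ S, ∀ t ∈ S, ∀ w : A, s * w * t ∈ S) {x y : A} (hy : y ∈ S) (hx : 0 ≤ x)
    (hxy : x ≤ y) : x ∈ S := by
  obtain ⟨l, _, hsa, hl⟩ := exists_filter_tendsto_mul hS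
  obtain ⟨r, rfl⟩ := CStarAlgebra.nonneg_iff_eq_mul_star_self.1 hx
  have hlim := (hl y hy r hxy).mul (hl y hy r hxy).star
  refine hS.mem_of_tendsto hlim ?_
  filter_upwards [hsa] with e he
  simpa only [star_mul, he.star_eq, mul_assoc, SetLike.mem_coe] using
    hcorner e e.2 e e.2 (r * star r)

theorem mul_mul_mem_of_hereditary {S : NonUnitalStarSubalgebra ℂ A}
    (hS : ∀ x y : A, y ∈ S → 0 ≤ x → x ≤ y → x ∈ S) {s t : A} (hs : s ∈ S) (ht : t ∈ S) (w : A) :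
    s * w * t ∈ S := by
  have hconj : ∀ w : A, 0 ≤ w → ∀ s ∈ S, star s * w * s ∈ S := by
    intro w hw s hs
    refine hS _ (‖w‖ • (star s * s)) ?_ (star_left_conjugate_nonneg hw s)
      (CStarAlgebra.star_left_conjugate_le_norm_smul (.of_nonneg hw))
    rw [← Complex.coe_smul]
    exact SMulMemClass.smul_mem _ (mul_mem (star_mem hs) hs)
  have hw : w ∈ Submodule.span ℂ {a : A | 0 ≤ a} := by simp [CStarAlgebra.span_nonneg]
  induction hw using Submodule.span_induction with
  | mem w hw =>
    have hsmul : ∀ c : ℂ, c • t ∈ S := fun c => SMulMemClass.smul_mem c ht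
    have hs' := star_mem hs
    rw [← star_star s, ← inv_smul_smul₀ (by norm_num : (4 : ℂ) ≠ 0) (star (star s) * w * t),
      four_smul_star_mul_mul_eq]
    refine SMulMemClass.smul_mem _ (add_mem (sub_mem (sub_mem ?_ ?_)
      (SMulMemClass.smul_mem _ ?_)) (SMulMemClass.smul_mem _ ?_))
    · exact hconj w hw _ (add_mem hs' ht)
    · exact hconj w hw _ (sub_mem hs' ht)
    · exact hconj w hw _ (add_mem hs' (hsmul _))
    · exact hconj w hw _ (sub_mem hs' (hsmul _))
  | zero => simp
  | add v w _ _ hv hw => rw [mul_add, add_mul]; exact add_mem hv hw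
  | smul c w _ hw => rw [mul_smul_comm, smul_mul_assoc]; exact SMulMemClass.smul_mem c hw

end HereditarySubalgebras

section WeakTopology

variable {X : Type*} [NormedAddCommGroup X] [NormedSpace ℂ X]

/-- The first axiom of a dual pair: the functionals of norm at most one in `F` determine the norm
of `X`. -/
def IsNorming (F : Submodule ℂ (StrongDual ℂ X)) : Prop :=
  ∀ x : X, IsLUB {r : ℝ | ∃ φ ∈ F, ‖φ‖ ≤ 1 ∧ r = ‖φ x‖} ‖x‖

/-- The Krein property of the `F`-topology: convex hulls of relatively `F`-compact sets are
relatively `F`-compact. -/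
def HasKreinProperty (F : Submodule ℂ (StrongDual ℂ X)) : Prop :=
  ∀ K : Set X, @IsCompact X (weakTop F) (closure[weakTop F] K) →
    @IsCompact X (weakTop F) (closure[weakTop F] (convexHull ℝ K))

variable {F : Submodule ℂ (StrongDual ℂ X)}

theorem continuous_weakTop_apply {φ : StrongDual ℂ X} (hφ : φ ∈ F) :
    Continuous[weakTop F, inferInstance] φ :=
  @Continuous.comp X (F → ℂ) ℂ (weakTop F) _ _ (fun x ψ => (ψ : StrongDual ℂ X) x) _
    (continuous_apply (⟨φ, hφ⟩ : F)) continuous_induced_dom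

theorem continuous_weakTop_rng {Y : Type*} [TopologicalSpace Y] {f : Y → X} :
    Continuous[inferInstance, weakTop F] f ↔ ∀ φ ∈ F, Continuous fun y => φ (f y) := by
  rw [continuous_induced_rng, continuous_pi_iff]
  exact Subtype.forall

theorem norm_le_weakTop : (inferInstance : TopologicalSpace X) ≤ weakTop F :=
  continuous_iff_le_induced.1 (continuous_pi fun φ : F => (φ : StrongDual ℂ X).continuous)

theorem exists_mem_eq_of_continuous_weakTop {f : X →ₗ[ℂ] ℂ}
    (hf : Continuous[weakTop F, inferInstance] f) : ∃ φ ∈ F, ∀ x, φ x = f x := by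
  let coeLM : StrongDual ℂ X →ₗ[ℂ] X →ₗ[ℂ] ℂ := ContinuousLinearMap.coeLM ℂ
  have hspan : f ∈ Submodule.span ℂ (Set.range fun ψ : F => coeLM ψ) := by
    rw [LinearMap.mem_span_iff_continuous]
    convert hf using 1
    rw [weakTop, induced_to_pi]
    rfl
  have hrange : (Set.range fun ψ : F => coeLM ψ) = (F.map coeLM : Set (X →ₗ[ℂ] ℂ)) := by
    ext
    simp
  rw [hrange, Submodule.span_eq] at hspan
  obtain ⟨φ, hφ, rfl⟩ := hspan
  exact ⟨φ, hφ, fun _ => rfl⟩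

theorem isTopologicalAddGroup_weakTop : @IsTopologicalAddGroup X (weakTop F) _ :=
  topologicalAddGroup_induced
    (LinearMap.pi fun φ : F => (φ : StrongDual ℂ X).toLinearMap : X →ₗ[ℂ] F → ℂ)

theorem continuousConstSMul_weakTop : @ContinuousConstSMul ℂ X (weakTop F) _ :=
  let _ := weakTop F
  ⟨fun c => continuous_weakTop_rng.2 fun φ hφ =>
    ((continuous_weakTop_apply hφ).const_smul c).congr fun x => (map_smul φ c x).symm⟩

theorem IsNorming.eq_zero (hF : IsNorming F) {x : X} (h : ∀ φ ∈ F, φ x = 0) : x = 0 := by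
  refine norm_le_zero_iff.1 ((hF x).2 ?_)
  rintro r ⟨φ, hφ, -, rfl⟩
  simp [h φ hφ]

theorem IsNorming.ext (hF : IsNorming F) {x y : X} (h : ∀ φ ∈ F, φ x = φ y) : x = y :=
  sub_eq_zero.1 (hF.eq_zero fun φ hφ => by rw [map_sub, h φ hφ, sub_self])

theorem IsNorming.t2Space_weakTop (hF : IsNorming F) : @T2Space X (weakTop F) :=
  let _ := weakTop F
  .of_injective_continuous (fun _ _ h => hF.ext fun φ hφ => congrFun h ⟨φ, hφ⟩)
    continuous_induced_dom

theorem IsNorming.isClosed_weakTop_norm_le (hF : IsNorming F) (t : ℝ) :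
    IsClosed[weakTop F] {x : X | ‖x‖ ≤ t} := by
  let _ := weakTop F
  have hball : {x : X | ‖x‖ ≤ t} = ⋂ φ ∈ F, ⋂ _ : ‖φ‖ ≤ 1, {x | ‖φ x‖ ≤ t} := by
    ext x
    simp only [Set.mem_ofPred_eq, Set.mem_iInter, isLUB_le_iff (hF x), mem_upperBounds]
    exact ⟨fun h φ hφ h₁ => h _ ⟨φ, hφ, h₁, rfl⟩, by rintro h _ ⟨φ, hφ, h₁, rfl⟩; exact h φ hφ h₁⟩
  rw [hball]
  exact isClosed_biInter fun φ hφ => isClosed_iInter fun _ =>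
    isClosed_le (continuous_weakTop_apply hφ).norm continuous_const

end WeakTopology

section WeakIntegral

open MeasureTheory

theorem integral_pi_mem_closure_convexHull {ι E K : Type*} [NormedAddCommGroup E]
    [NormedSpace ℝ E] [CompleteSpace E] [TopologicalSpace K] [CompactSpace K] [MeasurableSpace K]
    [OpensMeasurableSpace K] (μ : Measure K) [IsProbabilityMeasure μ] {f : K → ι → E}
    (hf : Continuous f) :
    (fun i => ∫ k, f k i ∂μ) ∈ closure (convexHull ℝ (Set.range f)) := by
  rw [mem_closure_iff]
  intro U hU hpU
  obtain ⟨I, u, hu, hIU⟩ := isOpen_pi_iff.1 hU _ hpU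
  let T : (ι → E) →L[ℝ] (I → E) := ContinuousLinearMap.pi fun i => .proj i.1
  have hint : Integrable (fun k => T (f k)) μ :=
    (T.continuous.comp hf).integrable_of_hasCompactSupport (.of_compactSpace _)
  have hmem : ∫ k, T (f k) ∂μ ∈ closure (T '' convexHull ℝ (Set.range f)) :=
    ((convex_convexHull ℝ _).linear_image T.toLinearMap).closure.integral_mem isClosed_closure
      (.of_forall fun k => subset_closure ⟨f k, subset_convexHull ℝ _ ⟨k, rfl⟩, rfl⟩) hint
  have hcoord (i : I) : (∫ k, T (f k) ∂μ) i = ∫ k, f k i ∂μ :=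
    ((ContinuousLinearMap.proj (R := ℝ) (φ := fun _ : I => E) i).integral_comp_comm hint).symm
  obtain ⟨_, hv, x, hx, rfl⟩ := mem_closure_iff.1 hmem (Set.univ.pi fun i : I => u i)
    (isOpen_set_pi Set.finite_univ fun i _ => (hu i i.2).1)
    (fun i _ => by rw [hcoord]; exact (hu i i.2).2)
  exact ⟨x, hIU fun i hi => hv ⟨i, hi⟩ trivial, hx⟩

variable {X : Type*} [NormedAddCommGroup X] [NormedSpace ℂ X] {K : Type*} [MeasurableSpace K]

/-- `p` is the integral of `f` with respect to `μ` in the `F`-topology. -/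
def IsWeakIntegral (F : Submodule ℂ (StrongDual ℂ X)) (μ : Measure K) (f : K → X) (p : X) : Prop :=
  ∀ φ ∈ F, φ p = ∫ k, φ (f k) ∂μ

variable {F : Submodule ℂ (StrongDual ℂ X)} {μ : Measure K} {f : K → X}

theorem IsWeakIntegral.map {p : X} (hp : IsWeakIntegral F μ f p) {L : X → X}
    (hL : IsLinearMap ℂ L) (hcont : Continuous[weakTop F, weakTop F] L) :
    IsWeakIntegral F μ (fun k => L (f k)) (L p) := by
  intro φ hφ
  obtain ⟨ψ, hψ, h⟩ := exists_mem_eq_of_continuous_weakTop (f := φ.toLinearMap ∘ₗ hL.mk')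
    (@Continuous.comp X X ℂ (weakTop F) (weakTop F) _ L φ (continuous_weakTop_apply hφ) hcont)
  simpa [h] using hp ψ hψ

variable [TopologicalSpace K] [CompactSpace K] [OpensMeasurableSpace K] [IsProbabilityMeasure μ]

theorem HasKreinProperty.exists_isWeakIntegral (hF : HasKreinProperty F)
    (hf : Continuous[inferInstance, weakTop F] f) :
    ∃ p ∈ closure[weakTop F] (convexHull ℝ (Set.range f)), IsWeakIntegral F μ f p := by
  let ev : X →ₗ[ℝ] F → ℂ := LinearMap.pi fun φ => φ.1.toLinearMap.restrictScalars ℝ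
  let _ := weakTop F
  have hev : Continuous[weakTop F, _] ev := continuous_induced_dom
  have : R1Space X := .induced ev
  have hC : IsCompact (ev '' closure (convexHull ℝ (Set.range f))) :=
    (hF _ (isCompact_range hf).closure).image hev
  have hsub : closure (convexHull ℝ (Set.range (ev ∘ f))) ⊆
      ev '' closure (convexHull ℝ (Set.range f)) := by
    rw [Set.range_comp, ← ev.image_convexHull]
    exact closure_minimal (Set.image_mono subset_closure) hC.isClosed
  obtain ⟨p, hp, hpe⟩ := hsub (integral_pi_mem_closure_convexHull μ (hev.comp hf))
  exact ⟨p, hp, fun φ hφ => congrFun hpe ⟨φ, hφ⟩⟩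

end WeakIntegral

section PositiveWeakIntegrals

open MeasureTheory

theorem IsNorming.isClosed_weakTop_nonneg_and_norm_le {A : Type*} [NonUnitalCStarAlgebra A]
    [PartialOrder A] [StarOrderedRing A] {F : Submodule ℂ (StrongDual ℂ A)} (hF : IsNorming F)
    (hstar : @ContinuousStar A (weakTop F) _)
    (hmul : @SeparatelyContinuousMul A (weakTop F) _) (t : ℝ) :
    IsClosed[weakTop F] {x : A | 0 ≤ x ∧ ‖x‖ ≤ t} := by
  have hball := hF.isClosed_weakTop_norm_le
  have hT2 := hF.t2Space_weakTop
  have hgrp := isTopologicalAddGroup_weakTop (F := F)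
  let topA := weakTop F
  obtain ht | ht := lt_or_ge t 0
  · convert isClosed_empty
    exact Set.eq_empty_of_forall_notMem fun x hx => (ht.trans_le (norm_nonneg x)).not_ge hx.2
  have hset : {x : A | 0 ≤ x ∧ ‖x‖ ≤ t} = {x | star x = x} ∩ {x | ‖x‖ ≤ t} ∩
      ⋂ a : A, {x | ‖t • a - x * a‖ ≤ t * ‖a‖} := by
    ext x
    simp [nonneg_and_norm_le_iff ht, isSelfAdjoint_iff, and_assoc]
  rw [hset]
  refine ((isClosed_eq continuous_star continuous_id).inter (hball t)).inter
    (isClosed_iInter fun a => ?_)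
  exact (hball (t * ‖a‖)).preimage (continuous_const.sub (continuous_mul_const a))

variable {X : Type*} [NormedAddCommGroup X] [NormedSpace ℂ X] [PartialOrder X]
  [IsOrderedAddMonoid X] [PosSMulMono ℝ X] {F : Submodule ℂ (StrongDual ℂ X)}

theorem convex_nonneg_and_norm_le (t : ℝ) : Convex ℝ {x : X | 0 ≤ x ∧ ‖x‖ ≤ t} := by
  have hset : {x : X | 0 ≤ x ∧ ‖x‖ ≤ t} = Set.Ici 0 ∩ Metric.closedBall 0 t := by
    ext
    simp
  rw [hset]
  exact (convex_Ici 0).inter (convex_closedBall 0 t)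

variable {K : Type*} [TopologicalSpace K] [CompactSpace K] [MeasurableSpace K]
  [OpensMeasurableSpace K] {μ : Measure K} [IsProbabilityMeasure μ] {f : K → X} {t : ℝ}

theorem HasKreinProperty.exists_isWeakIntegral_nonneg (hK : HasKreinProperty F)
    (hpos : IsClosed[weakTop F] {x : X | 0 ≤ x ∧ ‖x‖ ≤ t})
    (hf : Continuous[inferInstance, weakTop F] f) (hf₀ : ∀ k, 0 ≤ f k) (hft : ∀ k, ‖f k‖ ≤ t) :
    ∃ p : X, 0 ≤ p ∧ IsWeakIntegral F μ f p := by
  obtain ⟨p, hp, hpf⟩ := hK.exists_isWeakIntegral (μ := μ) hf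
  have hmem : closure[weakTop F] (convexHull ℝ (Set.range f)) ⊆ {x | 0 ≤ x ∧ ‖x‖ ≤ t} :=
    @closure_minimal X (weakTop F) _ _ (convexHull_min
      (Set.range_subset_iff.2 fun k => ⟨hf₀ k, hft k⟩) (convex_nonneg_and_norm_le t)) hpos
  exact ⟨p, (hmem hp).1, hpf⟩

theorem IsWeakIntegral.smul_of_eq_zero (hF : IsNorming F) (hK : HasKreinProperty F)
    (hpos : ∀ t : ℝ, IsClosed[weakTop F] {x : X | 0 ≤ x ∧ ‖x‖ ≤ t})
    (hf : Continuous[inferInstance, weakTop F] f) (hf₀ : ∀ k, 0 ≤ f k)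
    (hft : ∀ k, ‖f k‖ ≤ t) (h : IsWeakIntegral F μ f 0) {r : K → ℝ} (hr : Continuous r)
    (hr₀ : ∀ k, 0 ≤ r k) : IsWeakIntegral F μ (fun k => r k • f k) 0 := by
  obtain ⟨M, hM⟩ := (isCompact_range hr).bddAbove
  have hrM (k : K) : r k ≤ M := hM ⟨k, rfl⟩
  have hcont {s : K → ℝ} (hs : Continuous s) :
      Continuous[inferInstance, weakTop F] fun k => s k • f k :=
    continuous_weakTop_rng.2 fun φ hφ => (hs.smul (continuous_weakTop_rng.1 hf φ hφ)).congr
      fun k => (φ.map_smul_of_tower (s k) (f k)).symm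
  have hint {s : K → ℝ} (hs : Continuous s) (hs₀ : ∀ k, 0 ≤ s k) (hsM : ∀ k, s k ≤ M) :
      ∃ p : X, 0 ≤ p ∧ IsWeakIntegral F μ (fun k => s k • f k) p := by
    refine hK.exists_isWeakIntegral_nonneg (hpos (M * t)) (hcont hs)
      (fun k => smul_nonneg (hs₀ k) (hf₀ k)) fun k => ?_
    rw [norm_smul, Real.norm_of_nonneg (hs₀ k)]
    exact mul_le_mul (hsM k) (hft k) (norm_nonneg _) ((hs₀ k).trans (hsM k))
  -- `M • ∫ f = ∫ r • f + ∫ (M - r) • f` is a sum of two positive elements equal to zero.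
  obtain ⟨p, hp₀, hp⟩ := hint hr hr₀ hrM
  have hMr : Continuous fun k => M - r k := continuous_const.sub hr
  obtain ⟨q, hq₀, hq⟩ := hint hMr (fun k => sub_nonneg.2 (hrM k)) fun k => sub_le_self M (hr₀ k)
  have hpq : p + q = 0 := hF.eq_zero fun φ hφ => by
    have hφint {s : K → ℝ} (hs : Continuous s) : Integrable (fun k => φ (s k • f k)) μ :=
      (continuous_weakTop_rng.1 (hcont hs) φ hφ).integrable_of_hasCompactSupport
        (.of_compactSpace _)
    have h₀ : ∫ k, φ (f k) ∂μ = 0 := (h φ hφ).symm.trans (map_zero φ)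
    rw [map_add, hp φ hφ, hq φ hφ, ← integral_add (hφint hr) (hφint hMr)]
    simp only [← add_smul, add_sub_cancel, φ.map_smul_of_tower, integral_smul, h₀,
      smul_zero]
  rwa [((add_eq_zero_iff_of_nonneg hp₀ hq₀).1 hpq).1] at hp

theorem IsWeakIntegral.eq_zero_of_nonneg [μ.IsOpenPosMeasure] (hF : IsNorming F)
    (hK : HasKreinProperty F)
    (hpos : ∀ t : ℝ, IsClosed[weakTop F] {x : X | 0 ≤ x ∧ ‖x‖ ≤ t})
    (hf : Continuous[inferInstance, weakTop F] f) (hf₀ : ∀ k, 0 ≤ f k)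
    (hft : ∀ k, ‖f k‖ ≤ t) (h : IsWeakIntegral F μ f 0) (k : K) : f k = 0 := by
  have hre : ∀ φ ∈ F, (φ (f k)).re ≤ 0 := fun φ hφ => by
    have hφf : Continuous fun k => φ (f k) := continuous_weakTop_rng.1 hf φ hφ
    let r : K → ℝ := fun k => max (φ (f k)).re 0
    have hr : Continuous r := (Complex.continuous_re.comp hφf).max continuous_const
    have hsq : ∫ k, r k ^ 2 ∂μ = 0 := by
      have hint := (hr.smul hφf).integrable_of_hasCompactSupport (μ := μ) (.of_compactSpace _)
      calc ∫ k, r k ^ 2 ∂μ = ∫ k, (r k • φ (f k)).re ∂μ := by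
            congr with k
            rcases max_cases (φ (f k)).re 0 with hk | hk <;> simp [r, hk.1, sq]
        _ = (∫ k, r k • φ (f k) ∂μ).re := Complex.reCLM.integral_comp_comm hint
        _ = 0 := by
            simpa using congrArg Complex.re (h.smul_of_eq_zero hF hK hpos hf hf₀ hft hr
              (fun _ => le_max_right _ _) φ hφ).symm
    by_contra! hk
    have hrk : r k ^ 2 ≠ 0 := pow_ne_zero 2 (lt_max_of_lt_left hk).ne'
    exact hsq.not_gt ((hr.pow 2).integral_pos_of_hasCompactSupport_nonneg_nonzero
      (.of_compactSpace _) (fun k => sq_nonneg (r k)) hrk)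
  refine hF.eq_zero fun φ hφ => Complex.normSq_eq_zero.1 ((Complex.normSq_nonneg _).antisymm' ?_)
  rw [← Complex.ofReal_re (Complex.normSq _), Complex.normSq_eq_conj_mul_self]
  exact hre _ (F.smul_mem (star (φ (f k))) hφ)

end PositiveWeakIntegrals

section FixedPoints

variable {X : Type*} [NonUnitalCStarAlgebra X] {G : Type*} [Group G] [TopologicalSpace G]

/-- An action of `G` on `X` as in the definition of an `F`-dynamical system, for a norming space
`F` with the Krein property. Nothing is asked of the topology `σ(F, X)`. -/
structure IsKreinDynamicalSystem (F : Submodule ℂ (StrongDual ℂ X)) (α : G →* (X ≃⋆ₐ[ℂ] X)) :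
    Prop where
  isNorming : IsNorming F
  hasKreinProperty : HasKreinProperty F
  continuousStar : @ContinuousStar X (weakTop F) _
  separatelyContinuousMul : @SeparatelyContinuousMul X (weakTop F) _
  continuous_automorphism : ∀ g : G, Continuous[weakTop F, weakTop F] fun x : X => α g x
  continuous_orbit : ∀ x : X, Continuous[inferInstance, weakTop F] fun g : G => α g x

variable {F : Submodule ℂ (StrongDual ℂ X)} {α : G →* (X ≃⋆ₐ[ℂ] X)}

omit [TopologicalSpace G] in
theorem star_mem_fixedPoints {x : X} (hx : x ∈ fixedPoints α) : star x ∈ fixedPoints α :=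
  fun g => by rw [map_star, hx g]

theorem IsFDynamicalSystem.isKreinDynamicalSystem (hα : IsFDynamicalSystem F α) :
    IsKreinDynamicalSystem F α where
  isNorming := hα.isDualPair.norm_eq_left
  hasKreinProperty := hα.isDualPair.convexHull_left
  continuousStar := let _ := weakTop F; ⟨hα.continuous_star⟩
  separatelyContinuousMul :=
    let _ := weakTop F; ⟨@hα.continuous_mul_left, @hα.continuous_mul_right⟩
  continuous_automorphism := hα.continuous_automorphism
  continuous_orbit x := continuous_weakTop_rng.2 (hα.continuous_orbit x)

open MeasureTheory

omit [TopologicalSpace G] in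
theorem apply_eq_of_isWeakIntegral_orbit [MeasurableSpace G] [MeasurableMul G] {μ : Measure G}
    [μ.IsMulLeftInvariant] (hF : IsNorming F)
    (hα : ∀ g : G, Continuous[weakTop F, weakTop F] fun x : X => α g x) {x p : X}
    (hp : IsWeakIntegral F μ (fun g => α g x) p) (h : G) : α h p = p := by
  refine hF.ext fun φ hφ => ?_
  calc φ (α h p) = ∫ g, φ (α h (α g x)) ∂μ := hp.map ⟨map_add _, map_smul _⟩ (hα h) φ hφ
    _ = ∫ g, φ (α (h * g) x) ∂μ := by simp only [map_mul, StarAlgEquiv.mul_apply]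
    _ = ∫ g, φ (α g x) ∂μ := integral_mul_left_eq_self (fun g => φ (α g x)) h
    _ = φ p := (hp φ hφ).symm

theorem IsKreinDynamicalSystem.eq_zero_of_mul_isWeakIntegral_orbit [PartialOrder X]
    [StarOrderedRing X] [CompactSpace G] [MeasurableSpace G] [OpensMeasurableSpace G]
    {μ : Measure G} [IsProbabilityMeasure μ] [μ.IsOpenPosMeasure]
    (hα : IsKreinDynamicalSystem F α) {u p : X}
    (hp : IsWeakIntegral F μ (fun g => α g (star u * u)) p) (hup : u * p = 0) : u = 0 := by
  have hstar := hα.continuousStar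
  have hmul := hα.separatelyContinuousMul
  let L : X → X := fun x => u * x * star u
  have hL : IsLinearMap ℂ L :=
    ⟨by simp [L, mul_add, add_mul], by simp [L, mul_smul_comm, smul_mul_assoc]⟩
  have hLcont : Continuous[weakTop F, weakTop F] L :=
    let _ := weakTop F
    (continuous_mul_const _).comp (continuous_const_mul u)
  have hint : IsWeakIntegral F μ (fun g => L (α g (star u * u))) 0 := by
    simpa [L, hup] using hp.map hL hLcont
  have hL₁ : L (α 1 (star u * u)) = 0 := by
    refine hint.eq_zero_of_nonneg (t := ‖u‖ * ‖star u * u‖ * ‖star u‖) hα.isNorming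
      hα.hasKreinProperty (hα.isNorming.isClosed_weakTop_nonneg_and_norm_le hstar hmul)
      (@Continuous.comp _ _ _ _ (weakTop F) (weakTop F) _ _ hLcont (hα.continuous_orbit _))
      (fun g => star_right_conjugate_nonneg (map_nonneg (α g) (star_mul_self_nonneg u)) u)
      (fun g => ?_) 1
    rw [← NonUnitalStarAlgHom.norm_map (α g) (EquivLike.injective _) (star u * u)]
    exact norm_mul₃_le
  have hsq : L (α 1 (star u * u)) = u * star u * star (u * star u) := by
    simp [L, mul_assoc]
  rwa [hsq, CStarRing.mul_star_self_eq_zero_iff, CStarRing.mul_star_self_eq_zero_iff] at hL₁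

theorem IsKreinDynamicalSystem.exists_fixedPoint_mul_ne_zero [PartialOrder X] [StarOrderedRing X]
    [IsTopologicalGroup G] [CompactSpace G] (hα : IsKreinDynamicalSystem F α)
    {Y : NonUnitalStarSubalgebra ℂ X} (hinv : ∀ g, ∀ y ∈ Y, α g y ∈ Y)
    (hclosed : IsClosed[weakTop F] (Y : Set X)) {u : X} (hu : u ∈ Y) (hu₀ : u ≠ 0) :
    ∃ y ∈ Y, y ∈ fixedPoints α ∧ u * y ≠ 0 := by
  borelize G
  let μ : Measure G := Measure.haarMeasure ⊤
  have : IsProbabilityMeasure μ := ⟨Measure.haarMeasure_self⟩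
  obtain ⟨p, hpmem, hp⟩ := hα.hasKreinProperty.exists_isWeakIntegral (μ := μ)
    (hα.continuous_orbit (star u * u))
  have hrange : Set.range (fun g => α g (star u * u)) ⊆ (Y : Set X) :=
    Set.range_subset_iff.2 fun g => hinv g _ (mul_mem (star_mem hu) hu)
  have hhull : closure[weakTop F] (convexHull ℝ (Set.range fun g => α g (star u * u))) ⊆
      (Y : Set X) :=
    @closure_minimal X (weakTop F) _ _
      (convexHull_min hrange (Y.toSubmodule.restrictScalars ℝ).convex) hclosed
  exact ⟨p, hhull hpmem,
    apply_eq_of_isWeakIntegral_orbit hα.isNorming hα.continuous_automorphism hp,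
    fun hup => hu₀ (hα.eq_zero_of_mul_isWeakIntegral_orbit hp hup)⟩

theorem IsKreinDynamicalSystem.eq_zero_of_fixedPoint_mul_mul_eq_zero [PartialOrder X]
    [StarOrderedRing X] [IsTopologicalGroup G] [CompactSpace G] (hα : IsKreinDynamicalSystem F α)
    {Y : NonUnitalStarSubalgebra ℂ X} (hinv : ∀ g, ∀ y ∈ Y, α g y ∈ Y)
    (hclosed : IsClosed[weakTop F] (Y : Set X)) {u : X} (hu : u ∈ Y)
    (h : ∀ x ∈ Y, x ∈ fixedPoints α → ∀ y ∈ Y, y ∈ fixedPoints α → x * u * y = 0) : u = 0 := by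
  by_contra hu₀
  obtain ⟨y, hy, hyα, huy⟩ := hα.exists_fixedPoint_mul_ne_zero hinv hclosed hu hu₀
  obtain ⟨x, hx, hxα, hx₀⟩ := hα.exists_fixedPoint_mul_ne_zero hinv hclosed
    (star_mem (mul_mem hu hy)) (star_ne_zero.2 huy)
  refine hx₀ (star_injective ?_)
  simpa [mul_assoc] using h _ (star_mem hx) (star_mem_fixedPoints hxα) y hy hyα

end FixedPoints

section ScalarMatrices

variable {X : Type*} [NonUnitalCStarAlgebra X] {n : ℕ}

theorem mul_mulScalarMatrix (a b : Matrix (Fin n) (Fin n) X) (u : Matrix (Fin n) (Fin n) ℂ) :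
    a * mulScalarMatrix b u = mulScalarMatrix (a * b) u := by
  ext i j
  simp only [mulScalarMatrix, Matrix.of_apply, Matrix.mul_apply, Finset.smul_sum, Finset.mul_sum,
    mul_smul_comm]
  exact Finset.sum_comm

theorem scalarMatrixMul_mul (u : Matrix (Fin n) (Fin n) ℂ) (a b : Matrix (Fin n) (Fin n) X) :
    scalarMatrixMul u a * b = scalarMatrixMul u (a * b) := by
  ext i j
  simp only [scalarMatrixMul, Matrix.of_apply, Matrix.mul_apply, Finset.smul_sum, Finset.sum_mul,
    smul_mul_assoc]
  exact Finset.sum_comm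

theorem mulScalarMatrix_mul (a b : Matrix (Fin n) (Fin n) X) (u : Matrix (Fin n) (Fin n) ℂ) :
    mulScalarMatrix a u * b = a * scalarMatrixMul u b := by
  ext i j
  simp only [mulScalarMatrix, scalarMatrixMul, Matrix.of_apply, Matrix.mul_apply, Finset.mul_sum,
    Finset.sum_mul, mul_smul_comm, smul_mul_assoc]
  exact Finset.sum_comm

theorem mulScalarMatrix_mulScalarMatrix (a : Matrix (Fin n) (Fin n) X)
    (u v : Matrix (Fin n) (Fin n) ℂ) :
    mulScalarMatrix (mulScalarMatrix a u) v = mulScalarMatrix a (u * v) := by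
  ext i j
  simp only [mulScalarMatrix, Matrix.of_apply, Matrix.mul_apply, Finset.smul_sum,
    Finset.sum_smul, smul_smul, mul_comm]
  exact Finset.sum_comm

theorem mulScalarMatrix_one (a : Matrix (Fin n) (Fin n) X) : mulScalarMatrix a 1 = a := by
  ext i j
  simp [mulScalarMatrix, Matrix.one_apply]

/-- The element `x ⊗ 1` of `X ⊗ Mₙ(ℂ)`. -/
abbrev tensorOne (n : ℕ) (x : X) : Matrix (Fin n) (Fin n) X :=
  Matrix.diagonal fun _ => x

theorem scalarMatrixMul_tensorOne (u : Matrix (Fin n) (Fin n) ℂ) (x : X) :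
    scalarMatrixMul u (tensorOne n x) = mulScalarMatrix (tensorOne n x) u := by
  ext i j
  simp [scalarMatrixMul, mulScalarMatrix, Matrix.diagonal_apply]

theorem conjTranspose_tensorOne (x : X) : (tensorOne n x).conjTranspose = tensorOne n (star x) :=
  Matrix.diagonal_conjTranspose _

theorem eq_zero_of_mul_conjTranspose_eq_zero [PartialOrder X] [StarOrderedRing X]
    {a : Matrix (Fin n) (Fin n) X} (h : a * a.conjTranspose = 0) : a = 0 := by
  ext i j
  have hrow : ∑ k, a i k * star (a i k) = 0 := congrFun (congrFun h i) i
  rw [Finset.sum_eq_zero_iff_of_nonneg fun k _ => mul_star_self_nonneg _] at hrow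
  exact (CStarRing.mul_star_self_eq_zero_iff _).1 (hrow j (Finset.mem_univ j))

theorem mul_conjTranspose_eq_zero_of_mul_conjTranspose_mul_eq_zero [PartialOrder X]
    [StarOrderedRing X] {a c : Matrix (Fin n) (Fin n) X} (h : a * c.conjTranspose * c = 0) :
    a * c.conjTranspose = 0 := by
  refine eq_zero_of_mul_conjTranspose_eq_zero ?_
  rw [Matrix.conjTranspose_mul, Matrix.conjTranspose_conjTranspose, ← Matrix.mul_assoc, h,
    Matrix.zero_mul]

variable {G : Type*} [Group G] {α : G →* (X ≃⋆ₐ[ℂ] X)} {x : X}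

theorem map_mul_tensorOne (hx : x ∈ fixedPoints α) (g : G) (a : Matrix (Fin n) (Fin n) X) :
    (a * tensorOne n x).map (fun y => α g y) = a.map (fun y => α g y) * tensorOne n x := by
  ext i j
  simp [hx g]

theorem map_tensorOne_mul (hx : x ∈ fixedPoints α) (g : G) (a : Matrix (Fin n) (Fin n) X) :
    (tensorOne n x * a).map (fun y => α g y) = tensorOne n x * a.map (fun y => α g y) := by
  ext i j
  simp [hx g]

end ScalarMatrices

section SpectralSubspaces

variable {X : Type*} [NonUnitalCStarAlgebra X] {G : Type*} [Group G] [TopologicalSpace G]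
  {F : Submodule ℂ (StrongDual ℂ X)} {α : G →* (X ≃⋆ₐ[ℂ] X)} {π : UnitaryIrrep G}

theorem UnitaryIrrep.mat_mul_mat_inv (π : UnitaryIrrep G) (g : G) :
    π.mat g * π.mat g⁻¹ = 1 := by
  simp only [UnitaryIrrep.mat]
  rw [← Submonoid.coe_mul, ← map_mul, mul_inv_cancel, map_one, Submonoid.coe_one]

theorem mem_adFixedPoints_iff {Y : Set X} {a : Matrix (Fin π.dim) (Fin π.dim) X} :
    a ∈ adFixedPoints α Y π ↔ (∀ i j, a i j ∈ Y) ∧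
      ∀ g, scalarMatrixMul (π.mat g) (a.map fun x => α g x) = mulScalarMatrix a (π.mat g) := by
  refine and_congr_right fun _ => forall_congr' fun g => ⟨fun h => ?_, fun h => ?_⟩
  · conv_rhs => rw [← h]
    rw [mulScalarMatrix_mulScalarMatrix, ← inv_inv g, inv_inv g⁻¹, π.mat_mul_mat_inv,
      mulScalarMatrix_one]
  · rw [h, mulScalarMatrix_mulScalarMatrix, π.mat_mul_mat_inv, mulScalarMatrix_one]

variable {Y Z : Set X} {a : Matrix (Fin π.dim) (Fin π.dim) X} {x : X}

theorem mul_tensorOne_mem_adFixedPoints (ha : a ∈ adFixedPoints α Y π) (hx : x ∈ fixedPoints α)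
    (hZ : ∀ y ∈ Y, y * x ∈ Z) : a * tensorOne _ x ∈ adFixedPoints α Z π := by
  rw [mem_adFixedPoints_iff] at ha ⊢
  refine ⟨fun i j => by simpa using hZ _ (ha.1 i j), fun g => ?_⟩
  rw [map_mul_tensorOne hx, ← scalarMatrixMul_mul, ha.2 g, mulScalarMatrix_mul,
    scalarMatrixMul_tensorOne, mul_mulScalarMatrix]

theorem tensorOne_mul_mem_adFixedPoints (ha : a ∈ adFixedPoints α Y π) (hx : x ∈ fixedPoints α)
    (hZ : ∀ y ∈ Y, x * y ∈ Z) : tensorOne _ x * a ∈ adFixedPoints α Z π := by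
  rw [mem_adFixedPoints_iff] at ha ⊢
  refine ⟨fun i j => by simpa using hZ _ (ha.1 i j), fun g => ?_⟩
  rw [map_tensorOne_mul hx, ← scalarMatrixMul_mul, scalarMatrixMul_tensorOne,
    mulScalarMatrix_mul, ha.2 g, mul_mulScalarMatrix]

theorem mul_tensorOne_mem_spectralSubspace (ha : a ∈ spectralSubspace α Y π)
    (hx : x ∈ fixedPoints α) (hZ : ∀ y ∈ Y, y * x ∈ Z) :
    a * tensorOne _ x ∈ spectralSubspace α Z π := by
  refine ⟨fun i j => by simpa using hZ _ (ha.1 i j), fun g => ?_⟩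
  rw [map_mul_tensorOne hx, ha.2 g, mulScalarMatrix_mul, scalarMatrixMul_tensorOne,
    mul_mulScalarMatrix]

theorem tensorOne_mul_mem_spectralSubspace (ha : a ∈ spectralSubspace α Y π)
    (hx : x ∈ fixedPoints α) (hZ : ∀ y ∈ Y, x * y ∈ Z) :
    tensorOne _ x * a ∈ spectralSubspace α Z π := by
  refine ⟨fun i j => by simpa using hZ _ (ha.1 i j), fun g => ?_⟩
  rw [map_tensorOne_mul hx, ha.2 g, mul_mulScalarMatrix]

theorem continuous_weakMatrixTop_entry {n : ℕ} (i j : Fin n) :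
    Continuous[weakMatrixTop F n, weakTop F] fun b : Matrix (Fin n) (Fin n) X => b i j :=
  let _ := weakMatrixTop F n
  continuous_weakTop_rng.2 fun φ hφ =>
    @Continuous.comp _ (F × Fin n × Fin n → ℂ) ℂ (weakMatrixTop F n) _ _
      (fun b p => (p.1 : StrongDual ℂ X) (b p.2.1 p.2.2)) _
      (continuous_apply ((⟨φ, hφ⟩, i, j) : F × Fin n × Fin n)) continuous_induced_dom

theorem isClosed_weakMatrixTop_mul_eq_zero (hF : IsNorming F)
    (hmul : @SeparatelyContinuousMul X (weakTop F) _) {n : ℕ} (a : Matrix (Fin n) (Fin n) X) :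
    IsClosed[weakMatrixTop F n] {b : Matrix (Fin n) (Fin n) X | a * b = 0} := by
  have hT2 := hF.t2Space_weakTop
  have hgrp := isTopologicalAddGroup_weakTop (F := F)
  have hentry (i j : Fin n) := continuous_weakMatrixTop_entry (F := F) i j
  let _ := weakTop F
  let _ := weakMatrixTop F n
  have hset : {b : Matrix (Fin n) (Fin n) X | a * b = 0} =
      ⋂ (i) (j), {b | ∑ k, a i k * b k j = 0} := by
    ext b
    simp [← Matrix.ext_iff, Matrix.mul_apply]
  rw [hset]
  exact isClosed_iInter fun i => isClosed_iInter fun j => isClosed_eq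
    (continuous_finsetSum _ fun k _ => (continuous_const_mul (a i k)).comp (hentry k j))
    continuous_const

theorem forall_mem_spectralIdeal_mul_eq_zero_iff [PartialOrder X] [StarOrderedRing X]
    (hF : IsNorming F) (hmul : @SeparatelyContinuousMul X (weakTop F) _) :
    (∀ b ∈ spectralIdeal F α Y π, a * b = 0) ↔
      ∀ c ∈ spectralSubspace α Y π, a * c.conjTranspose = 0 := by
  refine ⟨fun h c hc => ?_, fun h => ?_⟩
  · refine mul_conjTranspose_eq_zero_of_mul_conjTranspose_mul_eq_zero ?_
    rw [Matrix.mul_assoc]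
    exact h _ (@subset_closure _ (weakMatrixTop F π.dim) _ _
      (Submodule.subset_span ⟨c, hc, c, hc, rfl⟩))
  · refine @closure_minimal _ (weakMatrixTop F π.dim) _ _ ?_
      (isClosed_weakMatrixTop_mul_eq_zero hF hmul a)
    refine Submodule.span_le (p := LinearMap.ker (LinearMap.mulLeft ℂ a)) |>.2 ?_
    rintro _ ⟨c, hc, d, -, rfl⟩
    simp [← Matrix.mul_assoc, h c hc]

end SpectralSubspaces

section IdealCorners

variable {X : Type*} [NonUnitalCStarAlgebra X] {G : Type*} [Group G]
  {F : Submodule ℂ (StrongDual ℂ X)} {α : G →* (X ≃⋆ₐ[ℂ] X)} {J : Submodule ℂ X}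

theorem IsFixedPointIdeal.star_mem [PartialOrder X] [StarOrderedRing X]
    (hJ : IsFixedPointIdeal F α J) {j : X} (hj : j ∈ J) : star j ∈ J := by
  have hclosed : IsClosed (J : Set X) := hJ.isClosed.mono norm_le_weakTop
  let S : NonUnitalStarSubalgebra ℂ X :=
    { carrier := {x | x ∈ J ∧ star x ∈ J}
      add_mem' := fun ha hb => ⟨add_mem ha.1 hb.1, by simpa using add_mem ha.2 hb.2⟩
      zero_mem' := by simp
      mul_mem' := fun ha hb => ⟨hJ.mul_mem_left _ (hJ.subset ha.1) _ hb.1,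
        by simpa using hJ.mul_mem_left _ (hJ.subset hb.2) _ ha.2⟩
      smul_mem' := fun c x hx => ⟨J.smul_mem c hx.1, by simpa using J.smul_mem _ hx.2⟩
      star_mem' := fun hx => ⟨hx.2, by simpa using hx.1⟩ }
  have hS : IsClosed (S : Set X) := hclosed.inter (hclosed.preimage continuous_star)
  have hjα : star j ∈ fixedPoints α := star_mem_fixedPoints (hJ.subset hj)
  have hjj : star j * star (star j) ∈ S := by
    have h : star j * j ∈ J := hJ.mul_mem_left _ hjα _ hj
    exact ⟨by simpa using h, by simpa using h⟩
  obtain ⟨l, _, -, hl⟩ := exists_filter_tendsto_mul hS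
  exact hclosed.mem_of_tendsto (hl _ hjj _ le_rfl)
    (.of_forall fun e => hJ.mul_mem_right _ hjα _ e.2.1)

theorem mul_mul_mem_idealCorner {j k : X} (hj : j ∈ J) (x : X) (hk : k ∈ J) :
    j * x * k ∈ idealCorner F J :=
  @subset_closure _ (weakTop F) _ _ (Submodule.subset_span ⟨j, hj, x, k, hk, rfl⟩)

theorem mul_eq_zero_of_mem_idealCorner (hF : IsNorming F)
    (hmul : @SeparatelyContinuousMul X (weakTop F) _) {u z : X} (hu : ∀ j ∈ J, u * j = 0)
    (hz : z ∈ idealCorner F J) : u * z = 0 := by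
  have hT2 := hF.t2Space_weakTop
  have hclosed : IsClosed[weakTop F] {z : X | u * z = 0} :=
    let _ := weakTop F
    isClosed_eq (continuous_const_mul u) continuous_const
  have hspan : Submodule.span ℂ {z : X | ∃ j ∈ J, ∃ x : X, ∃ k ∈ J, z = j * x * k} ≤
      LinearMap.ker (LinearMap.mulLeft ℂ u) := by
    refine Submodule.span_le.2 ?_
    rintro _ ⟨j, hj, x, k, -, rfl⟩
    simp [← mul_assoc, hu j hj]
  have hcorner : idealCorner F J ⊆ {z | u * z = 0} :=
    @closure_minimal X (weakTop F) _ _ hspan hclosed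
  exact hcorner hz

variable [PartialOrder X] [StarOrderedRing X]

/-- The linear span of `JXJ` as a star subalgebra of `X`; `idealCorner F J` is its `F`-closure. -/
def IsFixedPointIdeal.cornerSpan (hJ : IsFixedPointIdeal F α J) : NonUnitalStarSubalgebra ℂ X where
  toSubmodule := Submodule.span ℂ {z : X | ∃ j ∈ J, ∃ x : X, ∃ k ∈ J, z = j * x * k}
  mul_mem' {s t} hs ht := by
    refine LinearMap.BilinMap.apply_apply_mem_of_mem_span _ _ _ (LinearMap.mul ℂ X) ?_ s t hs ht
    rintro _ ⟨j, hj, x, k, -, rfl⟩ _ ⟨j', -, x', k', hk', rfl⟩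
    exact Submodule.subset_span ⟨j, hj, x * k * j' * x', k', hk', by simp [mul_assoc]⟩
  star_mem' {z} hz := by
    induction hz using Submodule.span_induction with
    | mem z hz =>
      obtain ⟨j, hj, x, k, hk, rfl⟩ := hz
      exact Submodule.subset_span
        ⟨star k, hJ.star_mem hk, star x, star j, hJ.star_mem hj, by simp [mul_assoc]⟩
    | zero => simp
    | add x y _ _ hx hy => simpa using add_mem hx hy
    | smul c x _ hx => simpa using Submodule.smul_mem _ _ hx

variable [TopologicalSpace G]

/-- The star subalgebra of `X` with underlying set `idealCorner F J`, a candidate for membership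
in `H_σ^α(X)`. -/
noncomputable def IsKreinDynamicalSystem.corner (hα : IsKreinDynamicalSystem F α)
    (hJ : IsFixedPointIdeal F α J) : NonUnitalStarSubalgebra ℂ X :=
  let _ := weakTop F
  have := hα.continuousStar
  have := hα.separatelyContinuousMul
  have := isTopologicalAddGroup_weakTop (F := F)
  have := continuousConstSMul_weakTop (F := F)
  have : IsSemitopologicalSemiring X := {}
  hJ.cornerSpan.topologicalClosure

theorem IsKreinDynamicalSystem.mul_mul_mem_corner (hα : IsKreinDynamicalSystem F α)
    (hJ : IsFixedPointIdeal F α J) {s t : X} (hs : s ∈ hα.corner hJ) (ht : t ∈ hα.corner hJ)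
    (w : X) : s * w * t ∈ hα.corner hJ := by
  let _ := weakTop F
  have := hα.separatelyContinuousMul
  refine map_mem_closure₂' (f := fun s t => s * w * t) (fun s => continuous_const_mul _)
    (fun t => (continuous_mul_const t).comp (continuous_mul_const w)) hs ht fun s hs t ht => ?_
  refine LinearMap.BilinMap.apply_apply_mem_of_mem_span _ _ _
    (LinearMap.mul ℂ X ∘ₗ LinearMap.mulRight ℂ w) ?_ s t hs ht
  rintro _ ⟨j, hj, x, k, -, rfl⟩ _ ⟨j', -, x', k', hk', rfl⟩
  exact Submodule.subset_span ⟨j, hj, x * k * w * j' * x', k', hk', by simp [mul_assoc]⟩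

theorem IsKreinDynamicalSystem.map_mem_corner (hα : IsKreinDynamicalSystem F α)
    (hJ : IsFixedPointIdeal F α J) (g : G) {z : X} (hz : z ∈ hα.corner hJ) :
    α g z ∈ hα.corner hJ := by
  let _ := weakTop F
  refine map_mem_closure (hα.continuous_automorphism g) hz fun z hz => ?_
  induction hz using Submodule.span_induction with
  | mem z hz =>
    obtain ⟨j, hj, x, k, hk, rfl⟩ := hz
    exact Submodule.subset_span ⟨j, hj, α g x, k, hk,
      by rw [map_mul, map_mul, hJ.subset hj g, hJ.subset hk g]⟩
  | zero => simp
  | add x y _ _ hx hy => simpa using add_mem hx hy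
  | smul c x _ hx => simpa using SMulMemClass.smul_mem c hx

theorem IsKreinDynamicalSystem.isInvariantHereditary_corner (hα : IsKreinDynamicalSystem F α)
    (hJ : IsFixedPointIdeal F α J) : IsInvariantHereditary F α (hα.corner hJ) := by
  have hclosed : IsClosed[weakTop F] (hα.corner hJ : Set X) := @isClosed_closure _ (weakTop F) _
  refine ⟨fun hbot => ?_, fun g y => hα.map_mem_corner hJ g, hclosed, fun x y hy hx hxy =>
    mem_of_nonneg_of_le (hclosed.mono norm_le_weakTop)
      (fun s hs t ht => hα.mul_mul_mem_corner hJ hs ht) hy hx hxy⟩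
  obtain ⟨j, hj, hj₀⟩ := J.ne_bot_iff.1 hJ.ne_bot
  have hmem : j * star j * j ∈ hα.corner hJ := mul_mul_mem_idealCorner hj (star j) hj
  have hsq : j * star j * star (j * star j) = 0 := by
    rw [hbot, NonUnitalStarAlgebra.mem_bot] at hmem
    rw [star_mul, star_star, ← mul_assoc, hmem, zero_mul]
  rw [CStarRing.mul_star_self_eq_zero_iff, CStarRing.mul_star_self_eq_zero_iff] at hsq
  exact hj₀ hsq

end IdealCorners

section ConnesSpectrum

variable {X : Type*} [NonUnitalCStarAlgebra X] {G : Type*} [Group G] [TopologicalSpace G]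
  {F : Submodule ℂ (StrongDual ℂ X)} {α : G →* (X ≃⋆ₐ[ℂ] X)} {π : UnitaryIrrep G}

/-- The right annihilator in `X^α` of the entries of `b X₂(π)*`. It is a two-sided ideal of `X^α`,
and if `b` is orthogonal to the spectral ideal of a hereditary subalgebra, then this ideal yields a
corner whose spectral ideal annihilates the compressions of `b`. -/
def spectralAnnihilator (α : G →* (X ≃⋆ₐ[ℂ] X)) (b : Matrix (Fin π.dim) (Fin π.dim) X) :
    Submodule ℂ X where
  carrier := {j | j ∈ fixedPoints α ∧
    ∀ c ∈ spectralSubspace α Set.univ π, ∀ i k, (b * c.conjTranspose) i k * j = 0}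
  add_mem' hx hy := ⟨fun g => by rw [map_add, hx.1 g, hy.1 g],
    fun c hc i k => by rw [mul_add, hx.2 c hc, hy.2 c hc, add_zero]⟩
  zero_mem' := ⟨fun g => map_zero _, fun _ _ _ _ => mul_zero _⟩
  smul_mem' r x hx := ⟨fun g => by rw [map_smul, hx.1 g],
    fun c hc i k => by rw [mul_smul_comm, hx.2 c hc, smul_zero]⟩

variable {b : Matrix (Fin π.dim) (Fin π.dim) X}

theorem IsKreinDynamicalSystem.isClosed_spectralAnnihilator (hα : IsKreinDynamicalSystem F α) :
    IsClosed[weakTop F] (spectralAnnihilator α b : Set X) := by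
  have hT2 := hα.isNorming.t2Space_weakTop
  have hmul := hα.separatelyContinuousMul
  have hcont := hα.continuous_automorphism
  let _ := weakTop F
  have hset : (spectralAnnihilator α b : Set X) = (⋂ g, {j | α g j = j}) ∩
      ⋂ c ∈ spectralSubspace α Set.univ π, ⋂ (i) (k), {j | (b * c.conjTranspose) i k * j = 0} := by
    ext j
    simp [spectralAnnihilator, fixedPoints]
  rw [hset]
  exact (isClosed_iInter fun g => isClosed_eq (hcont g) continuous_id).inter
    (isClosed_biInter fun c _ => isClosed_iInter fun i => isClosed_iInter fun k =>
      isClosed_eq (continuous_const_mul _) continuous_const)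

theorem IsKreinDynamicalSystem.isFixedPointIdeal_spectralAnnihilator
    (hα : IsKreinDynamicalSystem F α) (hb : spectralAnnihilator α b ≠ ⊥) :
    IsFixedPointIdeal F α (spectralAnnihilator α b) where
  ne_bot := hb
  subset _ hj := hj.1
  isClosed := hα.isClosed_spectralAnnihilator
  mul_mem_left x hx j hj := by
    refine ⟨fun g => by rw [map_mul, hx g, hj.1 g], fun c hc i k => ?_⟩
    have hxc := tensorOne_mul_mem_spectralSubspace hc (star_mem_fixedPoints hx)
      fun _ _ => Set.mem_univ _
    have h := hj.2 _ hxc i k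
    rw [Matrix.conjTranspose_mul, conjTranspose_tensorOne, star_star, ← Matrix.mul_assoc,
      Matrix.mul_diagonal] at h
    rwa [← mul_assoc]
  mul_mem_right x hx j hj := ⟨fun g => by rw [map_mul, hx g, hj.1 g],
    fun c hc i k => by rw [← mul_assoc, hj.2 c hc, zero_mul]⟩

variable [PartialOrder X] [StarOrderedRing X]

theorem IsKreinDynamicalSystem.tensorOne_mul_mul_tensorOne_eq_zero
    (hα : IsKreinDynamicalSystem F α) (hb : b ∈ adFixedPoints α Set.univ π)
    (hess : IsEssentialIn (spectralIdeal F α (idealCorner F (spectralAnnihilator α b)) π)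
      (adFixedPoints α (idealCorner F (spectralAnnihilator α b)) π))
    {x y : X} (hx : x ∈ spectralAnnihilator α b) (hy : y ∈ spectralAnnihilator α b) :
    tensorOne _ x * b * tensorOne _ y = 0 := by
  have hmem : tensorOne _ x * b * tensorOne _ y ∈
      adFixedPoints α (idealCorner F (spectralAnnihilator α b)) π := by
    refine mul_tensorOne_mem_adFixedPoints (Y := Set.range (x * ·))
      (tensorOne_mul_mem_adFixedPoints hb hx.1 fun z _ => ⟨z, rfl⟩) hy.1 ?_
    rintro _ ⟨z, rfl⟩
    exact mul_mul_mem_idealCorner hx z hy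
  refine hess _ hmem ((forall_mem_spectralIdeal_mul_eq_zero_iff hα.isNorming
    hα.separatelyContinuousMul).2 fun c hc => ?_)
  have hcy : c * tensorOne _ (star y) ∈ spectralSubspace α Set.univ π :=
    mul_tensorOne_mem_spectralSubspace hc (star_mem_fixedPoints hy.1) fun _ _ => Set.mem_univ _
  have hassoc : tensorOne _ x * b * tensorOne _ y * c.conjTranspose =
      tensorOne _ x * (b * (c * tensorOne _ (star y)).conjTranspose) := by
    simp only [Matrix.conjTranspose_mul, conjTranspose_tensorOne, star_star, Matrix.mul_assoc]
  refine mul_conjTranspose_eq_zero_of_mul_conjTranspose_mul_eq_zero ?_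
  ext i k
  rw [Matrix.mul_apply]
  refine Finset.sum_eq_zero fun l _ => mul_eq_zero_of_mem_idealCorner hα.isNorming
    hα.separatelyContinuousMul (fun j hj => ?_) (hc.1 l k)
  rw [hassoc, Matrix.diagonal_mul, mul_assoc, hj.2 _ hcy, mul_zero]

variable {Y : NonUnitalStarSubalgebra ℂ X}

theorem mem_spectralAnnihilator_mul_tensorOne (hY : ∀ x y : X, y ∈ Y → 0 ≤ x → x ≤ y → x ∈ Y)
    {a : Matrix (Fin π.dim) (Fin π.dim) X}
    (ha : ∀ c ∈ spectralSubspace α (Y : Set X) π, a * c.conjTranspose = 0) {y z : X}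
    (hy : y ∈ Y) (hyα : y ∈ fixedPoints α) (hz : z ∈ Y) (hzα : z ∈ fixedPoints α) :
    y ∈ spectralAnnihilator α (a * tensorOne _ z) := by
  refine ⟨hyα, fun c hc i k => ?_⟩
  have hmem : tensorOne _ (star y) * (c * tensorOne _ (star z)) ∈
      spectralSubspace α (Y : Set X) π := by
    refine tensorOne_mul_mem_spectralSubspace (Y := Set.range (· * star z))
      (mul_tensorOne_mem_spectralSubspace hc (star_mem_fixedPoints hzα) fun w _ => ⟨w, rfl⟩)
      (star_mem_fixedPoints hyα) ?_
    rintro _ ⟨w, rfl⟩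
    simpa only [mul_assoc, SetLike.mem_coe] using
      mul_mul_mem_of_hereditary hY (star_mem hy) (star_mem hz) w
  have h := congrFun (congrFun (ha _ hmem) i) k
  rw [Matrix.conjTranspose_mul, Matrix.conjTranspose_mul, conjTranspose_tensorOne,
    conjTranspose_tensorOne, star_star, star_star, ← Matrix.mul_assoc, ← Matrix.mul_assoc,
    Matrix.mul_diagonal] at h
  exact h

theorem IsInvariantHereditary.isEssentialIn_spectralIdeal [IsTopologicalGroup G] [CompactSpace G]
    (hY : IsInvariantHereditary F α Y) (hα : IsKreinDynamicalSystem F α)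
    (hess : ∀ J : Submodule ℂ X, IsFixedPointIdeal F α J →
      IsEssentialIn (spectralIdeal F α (idealCorner F J) π) (adFixedPoints α (idealCorner F J) π)) :
    IsEssentialIn (spectralIdeal F α (Y : Set X) π) (adFixedPoints α (Y : Set X) π) := by
  intro a ha hann
  rw [forall_mem_spectralIdeal_mul_eq_zero_iff hα.isNorming hα.separatelyContinuousMul] at hann
  ext i k
  by_contra hik
  obtain ⟨z, hz, hzα, hazik⟩ :=
    hα.exists_fixedPoint_mul_ne_zero hY.invariant hY.isClosed (ha.1 i k) hik
  have hmem {y : X} (hy : y ∈ Y) (hyα : y ∈ fixedPoints α) :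
      y ∈ spectralAnnihilator α (a * tensorOne _ z) :=
    mem_spectralAnnihilator_mul_tensorOne hY.hereditary hann hy hyα hz hzα
  have hideal : IsFixedPointIdeal F α (spectralAnnihilator α (a * tensorOne _ z)) :=
    hα.isFixedPointIdeal_spectralAnnihilator
      ((Submodule.ne_bot_iff _).2 ⟨z, hmem hz hzα, right_ne_zero_of_mul hazik⟩)
  have hb : a * tensorOne _ z ∈ adFixedPoints α Set.univ π :=
    mul_tensorOne_mem_adFixedPoints ha hzα fun _ _ => Set.mem_univ _
  refine hazik (hα.eq_zero_of_fixedPoint_mul_mul_eq_zero hY.invariant hY.isClosed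
    (mul_mem (ha.1 i k) hz) fun x hx hxα y hy hyα => ?_)
  simpa using congrFun (congrFun (hα.tensorOne_mul_mul_tensorOne_eq_zero hb (hess _ hideal)
    (hmem hx hxα) (hmem hy hyα)) i) k

end ConnesSpectrum

theorem theorem4p1_general {X : Type*} [NonUnitalCStarAlgebra X] [PartialOrder X]
    [StarOrderedRing X] {G : Type*} [Group G] [TopologicalSpace G] [IsTopologicalGroup G]
    [CompactSpace G] (F : Submodule ℂ (StrongDual ℂ X)) (α : G →* (X ≃⋆ₐ[ℂ] X))
    (hα : IsKreinDynamicalSystem F α) :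
    connesSpectrum F α =
      ⋂ (J : Submodule ℂ X) (_ : IsFixedPointIdeal F α J),
        arvesonSpectrum F α (idealCorner F J) := by
  refine Set.Subset.antisymm
    (Set.subset_iInter₂ fun J hJ => Set.iInter₂_subset _ (hα.isInvariantHereditary_corner hJ))
    (Set.subset_iInter₂ fun Y hY π hπ => hY.isEssentialIn_spectralIdeal hα fun J hJ => ?_)
  exact Set.mem_iInter₂.1 hπ J hJ

theorem theorem4p1 {X : Type*} [NonUnitalCStarAlgebra X] [PartialOrder X] [StarOrderedRing X]
    {G : Type*} [Group G] [TopologicalSpace G] [IsTopologicalGroup G] [CompactSpace G] [T2Space G]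
    (F : Submodule ℂ (StrongDual ℂ X)) (α : G →* (X ≃⋆ₐ[ℂ] X)) (hα : IsFDynamicalSystem F α) :
    connesSpectrum F α =
      ⋂ (J : Submodule ℂ X) (_ : IsFixedPointIdeal F α J),
        arvesonSpectrum F α (idealCorner F J) :=
  theorem4p1_general F α hα.isKreinDynamicalSystem
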